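/- Let $r\ge 2$ be an integer. The $r$-color size-Ramsey number $\hat R_r(H)$ of a finite graph $H$ is the smallest number of edges in a finite graph $G$ with the property that every $r$-coloring of the edges of $G$ contains a monochromatic copy of $H$ (a not necessarily induced subgraph isomorphic to $H$). For every integer $\Delta\ge 1$ there is a constant $C=C(\Delta)>0$, depending only on $\Delta$, such that for every integer $r\ge 2$, every $n\ge 1$ and every tree $T$ on $n$ vertices with maximum degree at most $\Delta$, $$\hat R_r(T)\le C\,r^2\,(\log r)\,n .$$ -/

import Mathlib

namespace SizeRamsey

/-- Every `r`-coloring of the edges of `G` contains a monochromatic copy of `H`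
(a copy is a not necessarily induced subgraph isomorphic to `H`). -/
def Arrows {W V : Type*} (G : SimpleGraph W) (r : ℕ) (H : SimpleGraph V) : Prop :=
  ∀ c : G.EdgeLabeling (Fin r), ∃ i : Fin r, H.IsContained (c.labelGraph i)

/-- The `r`-color size-Ramsey number of `H`: the smallest number of edges in a finite graph `G`
such that every `r`-coloring of the edges of `G` contains a monochromatic copy of `H`.
It would be `⊤` if there were no such graph `G`. -/
noncomputable def sizeRamsey {V : Type*} (r : ℕ) (H : SimpleGraph V) : ℕ∞ :=
  sInf {m : ℕ∞ | ∃ (N : ℕ) (G : SimpleGraph (Fin N)), Arrows G r H ∧ G.edgeSet.encard = m}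

end SizeRamsey

/-! The host is a random multigraph with order `r * n` vertices and order `r * log r` edges per
vertex (for fixed Δ), in which every vertex set of size up to order `n` is sparse: fewer than `D`
edges per vertex, with `D` of order `log r` (`exists_locally_sparse`, a union bound). The most
frequent colour still has at least `(L + 1) * D` edges per vertex. A minimal vertex set `U` with
that density loses at least `(L + 1) * D * #S` edges when `S ⊆ U` is deleted. All of these lie
inside `S` and its neighbourhood, so local sparsity forces that neighbourhood to be large: the
colour class expands on `U` (`isContained_of_dense`). The Friedman–Pippenger theorem
(`isContained_of_expanding`) then embeds the tree. -/

namespace SizeRamsey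

open Finset

open scoped Classical in
/-- The set of all vertices that have a neighbour in `X`. -/
noncomputable def neighborhood {W : Type*} [Fintype W] (H : SimpleGraph W) (X : Finset W) :
    Finset W :=
  univ.filter fun y => ∃ x ∈ X, H.Adj x y

/-! ### Trees in expanding graphs -/

section FriedmanPippenger

variable {W : Type*} [Fintype W] {H : SimpleGraph W}

lemma mem_neighborhood {X : Finset W} {y : W} :
    y ∈ neighborhood H X ↔ ∃ x ∈ X, H.Adj x y := by
  simp [neighborhood]

open scoped Classical in
/-- The extension property of Friedman and Pippenger: `F` is the set of vertices already in use,
and `δ x` counts the neighbours of `x` already embedded. -/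
def IsGood (H : SimpleGraph W) (d n : ℕ) (F : Finset W) (δ : W → ℕ) : Prop :=
  ∀ X : Finset W, #X ≤ 2 * n → d * #X ≤ #(neighborhood H X \ F) + ∑ x ∈ X, δ x

-- Submodularity, the source of the closure of critical sets under union.
open scoped Classical in
lemma card_neighborhood_union_add_inter_le (F X Z : Finset W) :
    #(neighborhood H (X ∪ Z) \ F) + #(neighborhood H (X ∩ Z) \ F) ≤
      #(neighborhood H X \ F) + #(neighborhood H Z \ F) := by
  rw [← card_union_add_card_inter (neighborhood H X \ F)]
  refine Nat.add_le_add (card_le_card fun y hy => ?_) (card_le_card fun y hy => ?_)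
  · simp only [mem_union, mem_sdiff, mem_neighborhood] at hy ⊢
    grind
  · simp only [mem_inter, mem_sdiff, mem_neighborhood] at hy ⊢
    grind

open scoped Classical in
/-- A set for which the inequality in `IsGood` is tight. -/
def IsCritical (H : SimpleGraph W) (d n : ℕ) (F : Finset W) (δ : W → ℕ) (X : Finset W) : Prop :=
  #X ≤ 2 * n ∧ #(neighborhood H X \ F) + ∑ x ∈ X, δ x ≤ d * #X

-- Expansion by `d + 1` against tightness at `d` leaves a surplus `#X` that only `F` can absorb.
open scoped Classical in
lemma IsCritical.card_le {d n : ℕ} {F : Finset W} {δ : W → ℕ} {X : Finset W}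
    (hexp : ∀ X : Finset W, #X ≤ 2 * n → (d + 1) * #X ≤ #(neighborhood H X))
    (hX : IsCritical H d n F δ X) : #X ≤ #F := by
  have h1 := hexp X hX.1
  have h2 := card_le_card_sdiff_add_card (s := neighborhood H X) (t := F)
  have h3 := hX.2
  rw [add_mul] at h1
  omega

-- Critical sets have at most `#F ≤ n` elements, so the union stays within `2 * n`; submodularity
-- and goodness of the intersection give tightness.
open scoped Classical in
lemma IsCritical.union {d n : ℕ} {F : Finset W} {δ : W → ℕ} {X Z : Finset W}
    (hexp : ∀ X : Finset W, #X ≤ 2 * n → (d + 1) * #X ≤ #(neighborhood H X))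
    (hgood : IsGood H d n F δ) (hF : #F ≤ n)
    (hX : IsCritical H d n F δ X) (hZ : IsCritical H d n F δ Z) :
    IsCritical H d n F δ (X ∪ Z) := by
  have h1 := hX.card_le hexp
  have h2 := hZ.card_le hexp
  have h3 := card_union_add_card_inter X Z
  have h4 := hgood (X ∩ Z) (by omega)
  have h5 := sum_union_inter (s₁ := X) (s₂ := Z) (f := δ)
  have h6 := card_neighborhood_union_add_inter_le (H := H) F X Z
  have h7 := hX.2
  have h8 := hZ.2
  have h9 : d * #(X ∪ Z) + d * #(X ∩ Z) = d * #X + d * #Z := by rw [← mul_add, h3, mul_add]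
  exact ⟨by omega, by omega⟩

-- If every free neighbour `y` of `w` failed, each would lie in the neighbourhood of a critical set
-- avoiding `w`. The union of these sets is critical and sees all free neighbours of `w`, so adding
-- `w` gains only `δ w < d`, against goodness.
open scoped Classical in
lemma IsGood.exists_extension {d n : ℕ} {F : Finset W} {δ : W → ℕ} {w : W}
    (hexp : ∀ X : Finset W, #X ≤ 2 * n → (d + 1) * #X ≤ #(neighborhood H X))
    (hgood : IsGood H d n F δ) (hF : #F < n) (hw : δ w < d) :
    ∃ y, H.Adj w y ∧ y ∉ F ∧
      IsGood H d n (insert y F) fun x => δ x + (if x = w then 1 else 0) + if x = y then 1 else 0 := by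
  by_contra! hcon
  have hcrit : ∀ y, H.Adj w y → y ∉ F →
      ∃ X, IsCritical H d n F δ X ∧ w ∉ X ∧ y ∈ neighborhood H X := by
    intro y hy hyF
    have := hcon y hy hyF
    simp only [IsGood, not_forall, not_le, exists_prop] at this
    obtain ⟨X, hX, hlt⟩ := this
    simp only [sum_add_distrib, sum_ite_eq'] at hlt
    have h1 := hgood X hX
    have h2 : neighborhood H X \ insert y F = (neighborhood H X \ F).erase y := by
      ext z; simp; tauto
    rw [h2] at hlt
    -- Using `y` costs at most one neighbour, so a violation forces tightness, and `w ∉ X` since `δ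
    -- w` would repay the loss.
    by_cases hyX : y ∈ neighborhood H X
    · rw [card_erase_of_mem (by simp [hyX, hyF])] at hlt
      have h3 : 0 < #(neighborhood H X \ F) := card_pos.2 ⟨y, by simp [hyX, hyF]⟩
      refine ⟨X, ⟨hX, ?_⟩, fun hwX => ?_, hyX⟩
      · omega
      · rw [if_pos hwX] at hlt
        omega
    · rw [erase_eq_of_notMem (by simp [hyX])] at hlt
      omega
  have hall : ∀ Y : Finset W, (∀ y ∈ Y, H.Adj w y ∧ y ∉ F) →
      ∃ X, IsCritical H d n F δ X ∧ w ∉ X ∧ Y ⊆ neighborhood H X := by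
    intro Y
    induction Y using Finset.induction_on with
    | empty => exact fun _ => ⟨∅, ⟨by simp, by simp [neighborhood]⟩, by simp, by simp⟩
    | insert y Y _ ih =>
      intro hY
      obtain ⟨X, hX, hwX, hYX⟩ := ih fun z hz => hY z (mem_insert_of_mem hz)
      obtain ⟨Z, hZ, hwZ, hyZ⟩ := hcrit y (hY y (mem_insert_self _ _)).1 (hY y (mem_insert_self _ _)).2
      refine ⟨X ∪ Z, hX.union hexp hgood hF.le hZ, by simp [hwX, hwZ], fun z hz => ?_⟩
      rw [mem_neighborhood]
      rcases mem_insert.1 hz with rfl | hz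
      · obtain ⟨x, hx, hxz⟩ := mem_neighborhood.1 hyZ
        exact ⟨x, mem_union_right _ hx, hxz⟩
      · obtain ⟨x, hx, hxz⟩ := mem_neighborhood.1 (hYX hz)
        exact ⟨x, mem_union_left _ hx, hxz⟩
  obtain ⟨X, hX, hwX, hsub⟩ := hall (univ.filter fun y => H.Adj w y ∧ y ∉ F) (by simp)
  have h1 := hX.card_le hexp
  have h2 := hgood (insert w X) (by rw [card_insert_of_notMem hwX]; omega)
  have h3 : neighborhood H (insert w X) \ F ⊆ neighborhood H X \ F := by
    intro y hy
    obtain ⟨hy, hyF⟩ := mem_sdiff.1 hy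
    refine mem_sdiff.2 ⟨?_, hyF⟩
    obtain ⟨x, hx, hxy⟩ := mem_neighborhood.1 hy
    rcases mem_insert.1 hx with rfl | hx
    · exact hsub (by simp [hxy, hyF])
    · exact mem_neighborhood.2 ⟨x, hx, hxy⟩
  have h4 := card_le_card h3
  have h5 := hX.2
  rw [card_insert_of_notMem hwX, sum_insert hwX, mul_add] at h2
  omega

open scoped Classical in
lemma degree_induce_le {V : Type*} [Fintype V] (T : SimpleGraph V) (s : Set V) (v : s)
    [Fintype ((T.induce s).neighborSet v)] :
    (T.induce s).degree v ≤ T.degree v := by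
  rw [← SimpleGraph.card_neighborFinset_eq_degree, ← SimpleGraph.card_neighborFinset_eq_degree,
    ← card_map (Function.Embedding.subtype _)]
  refine card_le_card fun x hx => ?_
  simp at hx ⊢
  grind

open scoped Classical in
lemma degree_induce_compl_singleton_lt {V : Type*} [Fintype V] (T : SimpleGraph V) {l : V}
    (v : ({l}ᶜ : Set V)) [Fintype ((T.induce {l}ᶜ).neighborSet v)] (h : T.Adj v l) :
    (T.induce {l}ᶜ).degree v < T.degree v := by
  rw [← SimpleGraph.card_neighborFinset_eq_degree, ← SimpleGraph.card_neighborFinset_eq_degree,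
    ← card_map (Function.Embedding.subtype _)]
  refine card_lt_card (ssubset_iff_of_subset ?_ |>.2 ⟨l, by simpa using h, by simp⟩)
  intro x hx
  simp at hx ⊢
  grind

-- Induction by removing a leaf. The bound of `δ` by the tree degree guarantees that the leaf's
-- parent still has `δ < d`.
open scoped Classical in
lemma exists_good_embedding [Nonempty W] {d n : ℕ}
    (hexp : ∀ X : Finset W, #X ≤ 2 * n → (d + 1) * #X ≤ #(neighborhood H X)) :
    ∀ (m : ℕ), m + 1 ≤ n → ∀ (V : Type*) [Fintype V] (T : SimpleGraph V), T.IsTree →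
      Fintype.card V = m + 1 → (∀ v, T.degree v ≤ d) →
      ∃ (f : V → W) (δ : W → ℕ), Function.Injective f ∧ (∀ u v, T.Adj u v → H.Adj (f u) (f v)) ∧
        (∀ v, δ (f v) ≤ T.degree v) ∧ (∀ x ∉ univ.image f, δ x = 0) ∧
        IsGood H d n (univ.image f) δ := by
  intro m
  induction m with
  | zero =>
    intro _ V _ T hT hV _
    obtain ⟨v, hv⟩ := Fintype.card_eq_one_iff.1 hV
    have : Subsingleton V := ⟨fun a b => (hv a).trans (hv b).symm⟩
    obtain ⟨w⟩ := ‹Nonempty W›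
    refine ⟨fun _ => w, fun _ => 0, Function.injective_of_subsingleton _, ?_, by simp, by simp, ?_⟩
    · intro a b hab
      exact absurd (Subsingleton.elim a b) hab.ne
    · intro X hX
      rcases X.eq_empty_or_nonempty with rfl | hne
      · simp
      have h1 := hexp X hX
      have h2 := card_le_card_sdiff_add_card (s := neighborhood H X)
        (t := univ.image fun _ : V => w)
      have h3 : #(univ.image fun _ : V => w) ≤ 1 := card_image_le.trans_eq (by simpa using hV)
      have h4 := hne.card_pos
      rw [add_mul] at h1
      simp only [sum_const_zero]
      omega
  | succ m ih =>
    intro hm V _ T hT hV hdeg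
    have : Nontrivial V := Fintype.one_lt_card_iff_nontrivial.1 (by omega)
    obtain ⟨l, hl⟩ := hT.exists_vert_degree_one_of_nontrivial
    obtain ⟨p, hlp, hp⟩ := SimpleGraph.degree_eq_one_iff_existsUnique_adj.1 hl
    have hpl : p ∈ ({l}ᶜ : Set V) := by simpa using hlp.ne'
    have hVl : Fintype.card ({l}ᶜ : Set V) = m + 1 := by
      rw [Fintype.card_compl_set, hV]; simp
    obtain ⟨f, δ, hf, hhom, hδ, hδ0, hgood⟩ := ih (by omega) ({l}ᶜ : Set V) (T.induce {l}ᶜ)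
      ⟨hT.connected.induce_compl_singleton_of_degree_eq_one hl, hT.isAcyclic.induce _⟩
      hVl fun v => (degree_induce_le T _ v).trans (hdeg v)
    have hlt : _ < T.degree p := degree_induce_compl_singleton_lt T ⟨p, hpl⟩ hlp.symm
    have hcard : #(univ.image f) = m + 1 := by
      rw [card_image_of_injective _ hf, card_univ, hVl]
    obtain ⟨y, hy, hyF, hgood'⟩ := hgood.exists_extension (w := f ⟨p, hpl⟩) hexp (by omega)
      (((hδ _).trans_lt hlt).trans_le (hdeg p))
    have hyf : ∀ v, f v ≠ y := fun v h => hyF (h ▸ mem_image_of_mem f (mem_univ v))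
    let g : V → W := fun v => if h : v ∈ ({l}ᶜ : Set V) then f ⟨v, h⟩ else y
    have gl : g l = y := by simp [g]
    have gf : ∀ v (h : v ∈ ({l}ᶜ : Set V)), g v = f ⟨v, h⟩ := fun v h => dif_pos h
    have him : univ.image g = insert y (univ.image f) := by
      ext x
      simp only [mem_image, mem_univ, true_and, mem_insert]
      constructor
      · rintro ⟨v, rfl⟩
        by_cases h : v = l
        · left; rw [h, gl]
        · right; exact ⟨⟨v, h⟩, (gf v h).symm⟩
      · rintro (rfl | ⟨v, rfl⟩)
        · exact ⟨l, gl⟩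
        · exact ⟨v, gf v v.2⟩
    refine ⟨g, _, ?_, ?_, ?_, ?_, him ▸ hgood'⟩
    · intro a b hab
      by_cases ha : a = l <;> by_cases hb : b = l
      · rw [ha, hb]
      · rw [ha, gl, gf b hb] at hab; exact absurd hab.symm (hyf _)
      · rw [hb, gl, gf a ha] at hab; exact absurd hab (hyf _)
      · rw [gf a ha, gf b hb] at hab
        exact congrArg Subtype.val (hf hab)
    · intro a b hab
      by_cases ha : a = l <;> by_cases hb : b = l
      · exact absurd (ha.trans hb.symm) hab.ne
      · subst ha
        have := hp b hab
        subst this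
        rw [gl, gf _ hpl]; exact hy.symm
      · subst hb
        have := hp a hab.symm
        subst this
        rw [gl, gf _ hpl]; exact hy
      · rw [gf a ha, gf b hb]
        exact hhom ⟨a, ha⟩ ⟨b, hb⟩ hab
    · intro v
      by_cases hv : v = l
      · subst hv
        rw [gl, hδ0 y hyF, hl, if_neg (hyf _).symm]; simp
      · rw [gf v hv, if_neg (hyf _)]
        by_cases hvp : v = p
        · subst hvp
          have := (hδ ⟨v, hv⟩).trans_lt hlt
          simp only [if_true]
          omega
        · rw [if_neg fun h => hvp (congrArg Subtype.val (hf h))]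
          exact (hδ ⟨v, hv⟩).trans (degree_induce_le T _ _)
    · intro x hx
      rw [him, mem_insert, not_or] at hx
      rw [hδ0 x hx.2, if_neg hx.1, if_neg]
      rintro rfl
      exact hx.2 (mem_image_of_mem f (mem_univ _))

open scoped Classical in
/-- **Friedman–Pippenger**: an expanding graph contains every small tree of bounded degree. -/
theorem isContained_of_expanding [Nonempty W] {d : ℕ} {V : Type*} [Fintype V]
    {T : SimpleGraph V} (hT : T.IsTree) (hdeg : ∀ v, T.degree v ≤ d)
    (hexp : ∀ X : Finset W, #X ≤ 2 * Fintype.card V → (d + 1) * #X ≤ #(neighborhood H X)) :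
    T.IsContained H := by
  have := hT.connected.nonempty
  have hV : 0 < Fintype.card V := Fintype.card_pos
  obtain ⟨f, -, hf, hhom, -⟩ := exists_good_embedding hexp (Fintype.card V - 1) (by omega) V T hT
    (by omega) hdeg
  exact ⟨⟨⟨f, fun h => hhom _ _ h⟩, hf⟩⟩

end FriedmanPippenger

end SizeRamsey

namespace SizeRamsey

open Finset

/-! ### Locally sparse multigraphs by counting -/

section SparseMultigraph

lemma choose_le_three_mul_div_pow (a b : ℕ) (hb : 0 < b) :
    (a.choose b : ℝ) ≤ (3 * a / b) ^ b := by
  have hb' : (0 : ℝ) < b := by exact_mod_cast hb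
  have h1 := Nat.choose_le_pow_div (α := ℝ) b a
  have h2 := Real.pow_div_factorial_le_exp (b : ℝ) hb'.le b
  have h3 : Real.exp b ≤ 3 ^ b := by
    rw [← Real.exp_one_pow]
    exact pow_le_pow_left₀ (Real.exp_pos _).le Real.exp_one_lt_three.le _
  calc (a.choose b : ℝ) ≤ (a : ℝ) ^ b / b.factorial := h1
    _ = ((a : ℝ) / b) ^ b * ((b : ℝ) ^ b / b.factorial) := by
        rw [div_pow]; field_simp
    _ ≤ ((a : ℝ) / b) ^ b * 3 ^ b := by gcongr; exact h2.trans h3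
    _ = (3 * a / b) ^ b := by rw [← mul_pow]; ring

/-- The indices of the edges of the multigraph `f` that lie inside `S`. -/
def edgesInside {N M : ℕ} (f : Fin M → Fin N × Fin N) (S : Finset (Fin N)) : Finset (Fin M) :=
  univ.filter fun i => (f i).1 ∈ S ∧ (f i).2 ∈ S

lemma mem_edgesInside {N M : ℕ} {f : Fin M → Fin N × Fin N} {S : Finset (Fin N)} {i : Fin M} :
    i ∈ edgesInside f S ↔ (f i).1 ∈ S ∧ (f i).2 ∈ S := by
  simp [edgesInside]

/-- Union bound over the `t`-sets of indices sent into `S ×ˢ S`. -/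
lemma card_filter_le_edgesInside {N M : ℕ} (t : ℕ) (S : Finset (Fin N)) :
    #{f : Fin M → Fin N × Fin N | t ≤ #(edgesInside f S)} ≤
      M.choose t * ((#S ^ 2) ^ t * (N ^ 2) ^ (M - t)) := by
  have hsub : ({f : Fin M → Fin N × Fin N | t ≤ #(edgesInside f S)} : Finset _) ⊆
      (powersetCard t univ).biUnion fun J : Finset (Fin M) =>
        Fintype.piFinset fun i => if i ∈ J then S ×ˢ S else univ := by
    intro f hf
    obtain ⟨J, hJ, hJt⟩ := exists_subset_card_eq (mem_filter.1 hf).2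
    refine mem_biUnion.2 ⟨J, by simp [mem_powersetCard, hJt], ?_⟩
    rw [Fintype.mem_piFinset]
    intro i
    split_ifs with hi
    · exact mem_product.2 (mem_edgesInside.1 (hJ hi))
    · exact mem_univ _
  refine (card_le_card hsub).trans ((card_biUnion_le_card_mul _ _ _ ?_).trans_eq
    (congrArg (· * _) (by simp)))
  intro J hJ
  have hJt := (mem_powersetCard.1 hJ).2
  rw [Fintype.card_piFinset]
  have : ∀ i, #(if i ∈ J then S ×ˢ S else univ) = if i ∈ J then #S ^ 2 else N ^ 2 := by
    intro i; split_ifs <;> simp [sq]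
  simp only [this]
  rw [prod_ite, prod_const, prod_const]
  have h1 : #{i | i ∈ J} = t := by simpa using hJt
  have h2 : #{i | i ∉ J} = M - t := by
    rw [filter_not, card_sdiff_of_subset (filter_subset _ _), h1]; simp
  rw [h1, h2]

lemma sparse_term_bound {L r D K : ℕ} (hL : 0 < L) (hr : 0 < r) (hD : 0 < D)
    (hq : 288 * L * r ≤ 8 ^ D) {k : ℕ} (hk : 0 < k) (hkK : k ≤ K) :
    let N := 24 * L * r * K
    let M := L * D * r * N
    ((N.choose k * (M.choose (D * k) * ((k ^ 2) ^ (D * k) * (N ^ 2) ^ (M - D * k))) : ℕ) : ℝ) ≤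
      (1 / 4) ^ k * ((N : ℝ) ^ 2) ^ M := by
  intro N M
  have hK : 0 < K := hk.trans_le hkK
  have hN : 0 < N := by positivity
  have hL' : (0 : ℝ) < L := by exact_mod_cast hL
  have hr' : (0 : ℝ) < r := by exact_mod_cast hr
  have hD' : (0 : ℝ) < D := by exact_mod_cast hD
  have hk' : (0 : ℝ) < k := by exact_mod_cast hk
  have hK' : (0 : ℝ) < K := by exact_mod_cast hK
  have hN' : (0 : ℝ) < N := by exact_mod_cast hN
  have hNeq : (N : ℝ) = 24 * L * r * K := by simp [N]
  have hMeq : (M : ℝ) = L * D * r * N := by simp [M]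
  by_cases hM : M < D * k
  · rw [Nat.choose_eq_zero_of_lt hM]
    simp only [zero_mul, mul_zero, Nat.cast_zero]
    positivity
  push Not at hM
  have h1 := choose_le_three_mul_div_pow N k hk
  have h2 := choose_le_three_mul_div_pow M (D * k) (by positivity)
  have hsplit : ((N : ℝ) ^ 2) ^ M = ((N : ℝ) ^ 2) ^ (D * k) * ((N : ℝ) ^ 2) ^ (M - D * k) := by
    rw [← pow_add]; congr 1; omega
  have hy1 : (k : ℝ) / K ≤ 1 := (div_le_one hK').2 (by exact_mod_cast hkK)
  -- The factor 24 in `N` makes the inner ratio `k / (8 * K)`. One power of `k / K` turns `3 * N /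
  -- k` into `72 * L * r`, which `8 ^ D` beats by `hq`.
  have hbase : (3 * N / k : ℝ) * ((3 * M / (D * k : ℕ)) * (k ^ 2 / N ^ 2)) ^ D ≤ 1 / 4 := by
    have e1 : (3 * M / (D * k : ℕ)) * ((k : ℝ) ^ 2 / N ^ 2) = ((k : ℝ) / K) * (1 / 8) := by
      rw [hMeq, hNeq]; push_cast; field_simp; norm_num
    rw [e1, mul_pow]
    have e2 : ((k : ℝ) / K) ^ D ≤ k / K := pow_le_of_le_one (by positivity) hy1 hD.ne'
    have e3 : (288 * L * r : ℝ) ≤ 8 ^ D := by exact_mod_cast hq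
    calc (3 * N / k : ℝ) * (((k : ℝ) / K) ^ D * (1 / 8) ^ D)
        ≤ (3 * N / k : ℝ) * ((k / K) * (1 / 8) ^ D) := by gcongr
      _ = (72 * L * r) / 8 ^ D := by rw [hNeq, one_div, inv_pow]; field_simp; norm_num
      _ ≤ 1 / 4 := by rw [div_le_iff₀ (by positivity)]; linarith
  push_cast
  calc (N.choose k : ℝ) * (M.choose (D * k) * (((k : ℝ) ^ 2) ^ (D * k) * ((N : ℝ) ^ 2) ^ (M - D * k)))
      ≤ (3 * N / k) ^ k * ((3 * M / (D * k : ℕ)) ^ (D * k) *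
          (((k : ℝ) ^ 2) ^ (D * k) * ((N : ℝ) ^ 2) ^ (M - D * k))) := by gcongr
    _ = ((3 * N / k : ℝ) * ((3 * M / (D * k : ℕ)) * (k ^ 2 / N ^ 2)) ^ D) ^ k *
          ((N : ℝ) ^ 2) ^ M := by
        rw [hsplit, mul_pow _ _ k, ← pow_mul _ D k, mul_pow _ _ (D * k), div_pow ((k : ℝ) ^ 2)]
        field_simp
    _ ≤ (1 / 4) ^ k * ((N : ℝ) ^ 2) ^ M := by gcongr

/-- There is a multigraph with average degree of order `L * D * r` in which small vertex sets
are sparse. -/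
theorem exists_locally_sparse {L r D : ℕ} (hL : 0 < L) (hr : 0 < r) (hD : 0 < D)
    (hq : 288 * L * r ≤ 8 ^ D) (K : ℕ) :
    ∃ f : Fin (L * D * r * (24 * L * r * K)) → Fin (24 * L * r * K) × Fin (24 * L * r * K),
      ∀ S : Finset (Fin (24 * L * r * K)), S.Nonempty → #S ≤ K → #(edgesInside f S) < D * #S := by
  have hterm := fun k => sparse_term_bound (K := K) hL hr hD hq (k := k)
  simp only at hterm
  set N := 24 * L * r * K with hN
  set M := L * D * r * N with hM
  by_contra! hcon
  have hcover : (univ : Finset (Fin M → Fin N × Fin N)) ⊆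
      (Icc 1 K).biUnion fun k => (powersetCard k univ).biUnion fun S =>
        {f : Fin M → Fin N × Fin N | D * k ≤ #(edgesInside f S)} := by
    intro f _
    obtain ⟨S, hS, hSK, hSD⟩ := hcon f
    exact mem_biUnion.2 ⟨#S, mem_Icc.2 ⟨hS.card_pos, hSK⟩,
      mem_biUnion.2 ⟨S, by simp [mem_powersetCard], by simpa using hSD⟩⟩
  have hcount : (N ^ 2) ^ M ≤ ∑ k ∈ Icc 1 K,
      N.choose k * (M.choose (D * k) * ((k ^ 2) ^ (D * k) * (N ^ 2) ^ (M - D * k))) := by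
    have h0 : #(univ : Finset (Fin M → Fin N × Fin N)) = (N ^ 2) ^ M := by simp [sq]
    rw [← h0]
    refine (card_le_card hcover).trans (card_biUnion_le.trans (sum_le_sum fun k _ => ?_))
    refine (card_biUnion_le_card_mul _ _ _ fun S hS => ?_).trans_eq (congrArg (· * _) (by simp))
    have := card_filter_le_edgesInside (N := N) (M := M) (D * k) S
    rwa [(mem_powersetCard.1 hS).2] at this
  rcases Nat.eq_zero_or_pos K with rfl | hK
  · have hN0 : N = 0 := by simp [hN]
    have hM0 : M = 0 := by simp [hM, hN0]
    simp [hM0] at hcount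
  have hNpos : 0 < N := by positivity
  -- The bad multigraphs make up less than a third of all.
  have hgeom : ∀ K : ℕ, ∑ k ∈ Icc 1 K, (1 / 4 : ℝ) ^ k ≤ 1 / 3 - 1 / 3 * (1 / 4) ^ K := by
    intro K
    induction K with
    | zero => simp
    | succ K ih =>
      rw [sum_Icc_succ_top (by omega), pow_succ]
      linarith
  have hreal : ((N : ℝ) ^ 2) ^ M ≤ ∑ k ∈ Icc 1 K, (1 / 4 : ℝ) ^ k * ((N : ℝ) ^ 2) ^ M := by
    calc ((N : ℝ) ^ 2) ^ M = (((N ^ 2) ^ M : ℕ) : ℝ) := by push_cast; rfl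
      _ ≤ _ := Nat.cast_le.2 hcount
      _ ≤ _ := by
        rw [Nat.cast_sum]
        exact sum_le_sum fun k hk => hterm k (mem_Icc.1 hk).1 (mem_Icc.1 hk).2
  rw [← sum_mul] at hreal
  have hpos : (0 : ℝ) < ((N : ℝ) ^ 2) ^ M := by positivity
  have h1 := hgeom K
  have h2 : (0 : ℝ) < (1 / 4) ^ K := by positivity
  nlinarith

end SparseMultigraph

end SizeRamsey

namespace SizeRamsey

open Finset

/-! ### From a dense colour class to the tree -/

section Main

/-- The simple graph underlying the multigraph `f`. -/
def graphOfEdges {N M : ℕ} (f : Fin M → Fin N × Fin N) : SimpleGraph (Fin N) :=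
  SimpleGraph.fromEdgeSet (Set.range fun i => s((f i).1, (f i).2))

lemma encard_edgeSet_graphOfEdges_le {N M : ℕ} (f : Fin M → Fin N × Fin N) :
    (graphOfEdges f).edgeSet.encard ≤ M := by
  rw [graphOfEdges, SimpleGraph.edgeSet_fromEdgeSet]
  refine (Set.encard_le_encard Set.sdiff_subset).trans ?_
  rw [← Set.image_univ]
  refine Set.encard_image_le _ _ |>.trans ?_
  simp

lemma graphOfEdges_adj {N M : ℕ} {f : Fin M → Fin N × Fin N} {i : Fin M}
    (h : (f i).1 ≠ (f i).2) : (graphOfEdges f).Adj (f i).1 (f i).2 := by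
  rw [graphOfEdges, SimpleGraph.fromEdgeSet_adj]
  exact ⟨⟨i, rfl⟩, h⟩

open scoped Classical in
/-- Every dense submultigraph of a locally sparse multigraph contains an expanding subgraph, hence
all small trees of bounded degree. -/
theorem isContained_of_dense {N M L D n : ℕ} (hL : 0 < L) {f : Fin M → Fin N × Fin N}
    (hf : ∀ S : Finset (Fin N), S.Nonempty → #S ≤ 2 * n * (L + 1) →
      #(edgesInside f S) < D * #S)
    {E : Finset (Fin M)} (hN : 0 < N) (hE : (L + 1) * D * N ≤ #E) {H : SimpleGraph (Fin N)}
    (hH : ∀ i ∈ E, (f i).1 ≠ (f i).2 → H.Adj (f i).1 (f i).2)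
    {V : Type*} [Fintype V] {T : SimpleGraph V} (hT : T.IsTree) (hV : Fintype.card V = n)
    (hdeg : ∀ v, T.degree v + 1 ≤ L) : T.IsContained H := by
  have hne : Nonempty (Fin N) := ⟨⟨0, hN⟩⟩
  have hex : ∃ U : Finset (Fin N), U.Nonempty ∧ (L + 1) * D * #U ≤ #(E ∩ edgesInside f U) :=
    ⟨univ, univ_nonempty, by simpa [edgesInside] using hE⟩
  obtain ⟨U, hU⟩ := exists_minimal_of_wellFoundedLT _ hex
  obtain ⟨hUne, hUE⟩ := hU.prop
  have htouch : ∀ S ⊆ U, S.Nonempty →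
      (L + 1) * D * #S ≤ #((E ∩ edgesInside f U) \ edgesInside f (U \ S)) := by
    intro S hS hSne
    rcases (U \ S).eq_empty_or_nonempty with h | h
    · have : S = U := hS.antisymm (sdiff_eq_empty_iff_subset.1 h)
      subst this
      simpa [edgesInside] using hUE
    · have h1 : #(E ∩ edgesInside f (U \ S)) < (L + 1) * D * #(U \ S) := by
        by_contra! hcon
        have := hU.le_of_le ⟨h, hcon⟩ sdiff_subset
        obtain ⟨x, hx⟩ := hSne
        exact (mem_sdiff.1 (this (hS hx))).2 hx
      have h2 : #(U \ S) + #S = #U := card_sdiff_add_card_eq_card hS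
      have h3 : #(E ∩ edgesInside f U) ≤
          #((E ∩ edgesInside f U) \ edgesInside f (U \ S)) + #(E ∩ edgesInside f (U \ S)) := by
        rw [← card_sdiff_add_card_inter (E ∩ edgesInside f U) (edgesInside f (U \ S))]
        refine Nat.add_le_add_left (card_le_card fun i hi => ?_) _
        simp only [mem_inter] at hi ⊢
        exact ⟨hi.1.1, hi.2⟩
      rw [← h2, mul_add] at hUE
      omega
  have hUne' : Nonempty U := ⟨⟨_, hUne.choose_spec⟩⟩
  have hind : T.IsContained (H.induce (U : Set (Fin N))) := by
    refine isContained_of_expanding (W := U) (d := L - 1) hT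
      (fun v => by have := hdeg v; omega) fun X hX => ?_
    rcases X.eq_empty_or_nonempty with rfl | hXne
    · simp
    rw [hV] at hX
    rw [Nat.sub_add_cancel hL]
    set Γ := neighborhood (H.induce (U : Set (Fin N))) X with hΓ
    set S := X.map (Function.Embedding.subtype _) with hS
    -- `X` itself is included so that loops at `X`, which give no adjacency, are also counted inside
    -- `P`.
    set P := (X ∪ Γ).map (Function.Embedding.subtype _) with hP
    have hSU : S ⊆ U := fun x hx => by
      obtain ⟨y, -, rfl⟩ := mem_map.1 hx
      exact y.2
    have hScard : #S = #X := card_map _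
    have hPcard : #P ≤ #X + #Γ := (card_map _).trans_le (card_union_le _ _)
    have hSne : S.Nonempty := hXne.map
    have hSP : S ⊆ P := map_subset_map.2 subset_union_left
    have hinc : (E ∩ edgesInside f U) \ edgesInside f (U \ S) ⊆ edgesInside f P := by
      intro i hi
      obtain ⟨hi, hi'⟩ := mem_sdiff.1 hi
      obtain ⟨hiE, hiU⟩ := mem_inter.1 hi
      obtain ⟨h1, h2⟩ := mem_edgesInside.1 hiU
      have key : ∀ a b, a ∈ S → b ∈ U → (a ≠ b → H.Adj a b) → a ∈ P ∧ b ∈ P := by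
        intro a b ha hb hab
        refine ⟨hSP ha, ?_⟩
        by_cases h : a = b
        · exact h ▸ hSP ha
        · obtain ⟨x, hx, rfl⟩ := mem_map.1 ha
          exact mem_map.2 ⟨⟨b, hb⟩, mem_union_right _ (mem_neighborhood.2 ⟨x, hx, hab h⟩), rfl⟩
      rw [mem_edgesInside]
      by_cases h3 : (f i).1 ∈ S
      · exact key _ _ h3 h2 (hH i hiE)
      · by_cases h4 : (f i).2 ∈ S
        · exact (key _ _ h4 h1 fun h => (hH i hiE h.symm).symm).symm
        · exact absurd (mem_edgesInside.2 ⟨mem_sdiff.2 ⟨h1, h3⟩, mem_sdiff.2 ⟨h2, h4⟩⟩) hi'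
    have hlow := (htouch S hSU hSne).trans (card_le_card hinc)
    rw [hScard] at hlow
    have hgoal : (L + 1) * #X ≤ #P := by
      -- Beyond the range of sparsity, `P` is already large enough, because `#X ≤ 2 * n`.
      by_cases hPK : #P ≤ 2 * n * (L + 1)
      · have h1 := hf P (hSne.mono hSP) hPK
        have h2 : D * ((L + 1) * #X) < D * #P := by
          calc D * ((L + 1) * #X) = (L + 1) * D * #X := by ring
            _ < _ := hlow.trans_lt h1
        exact (Nat.lt_of_mul_lt_mul_left h2).le
      · push Not at hPK
        calc (L + 1) * #X ≤ (L + 1) * (2 * n) := Nat.mul_le_mul_left _ hX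
          _ = 2 * n * (L + 1) := by ring
          _ ≤ #P := hPK.le
    rw [add_mul] at hgoal
    omega
  exact hind.trans ⟨(SimpleGraph.Embedding.induce _).toCopy⟩

theorem exists_arrows {L r D n : ℕ} (hL : 0 < L) (hr : 0 < r) (hn : 0 < n)
    (hq : 288 * (L + 1) * r ≤ 8 ^ D) {V : Type*} [Fintype V] {T : SimpleGraph V}
    [DecidableRel T.Adj] (hT : T.IsTree) (hV : Fintype.card V = n)
    (hdeg : ∀ v, T.degree v + 1 ≤ L) :
    ∃ (N : ℕ) (G : SimpleGraph (Fin N)), Arrows G r T ∧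
      G.edgeSet.encard ≤ (((L + 1) * D * r * (24 * (L + 1) * r * (2 * n * (L + 1))) : ℕ) : ℕ∞) := by
  have hD : 0 < D := by
    rcases Nat.eq_zero_or_pos D with rfl | h
    · have : 0 < (L + 1) * r := by positivity
      rw [mul_assoc] at hq
      omega
    · exact h
  obtain ⟨f, hf⟩ := exists_locally_sparse L.succ_pos hr hD hq (2 * n * (L + 1))
  refine ⟨_, graphOfEdges f, fun c => ?_, encard_edgeSet_graphOfEdges_le f⟩
  have : Nonempty (Fin r) := ⟨⟨0, hr⟩⟩
  classical
  -- Loops get an arbitrary colour; the density argument tolerates them.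
  let color : Fin ((L + 1) * D * r * (24 * (L + 1) * r * (2 * n * (L + 1)))) → Fin r := fun i =>
    if h : (f i).1 ≠ (f i).2 then c ⟨s((f i).1, (f i).2), graphOfEdges_adj h⟩ else ⟨0, hr⟩
  obtain ⟨a, ha⟩ := Fintype.exists_le_card_fiber_of_mul_le_card (f := color)
    (n := (L + 1) * D * (24 * (L + 1) * r * (2 * n * (L + 1))))
    (by rw [Fintype.card_fin, Fintype.card_fin]; exact (by ring : _ = _).le)
  refine ⟨a, isContained_of_dense hL hf (by positivity) ha (fun i hi hne => ?_) hT hV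
    fun v => by convert hdeg v⟩
  rw [SimpleGraph.EdgeLabeling.labelGraph_adj]
  refine ⟨graphOfEdges_adj hne, ?_⟩
  have := (mem_filter.1 hi).2
  simp only [color] at this
  rwa [dif_pos hne] at this

end Main

end SizeRamsey

/-! ### Choice of constants -/

theorem mainTheorem9 (Δ : ℕ) (hΔ : 1 ≤ Δ) :
    ∃ C : ℝ, 0 < C ∧
      ∀ (r : ℕ), 2 ≤ r →
        ∀ (V : Type*) [Fintype V] (T : SimpleGraph V) [DecidableRel T.Adj],
          T.IsTree → T.maxDegree ≤ Δ →
            ∃ m : ℕ, SizeRamsey.sizeRamsey r T = (m : ℕ∞) ∧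
              (m : ℝ) ≤ C * (r : ℝ) ^ 2 * Real.log r * (Fintype.card V : ℝ) := by
  have hlog2 : 0 < Real.log 2 := Real.log_pos (by norm_num)
  refine ⟨48 * (Δ + 2) ^ 3 * (2 + 288 * (Δ + 2)) / Real.log 2, by positivity, ?_⟩
  intro r hr V _ T _ hT hdeg
  have := hT.connected.nonempty
  have hn : 0 < Fintype.card V := Fintype.card_pos
  -- The logarithm pays for the factor `r` in `hq`, and the last summand for `288 * (Δ + 2)`,
  -- through `x < 2 ^ x`.
  set D := Nat.log 2 r + 1 + 288 * (Δ + 2) with hD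
  have hq : 288 * (Δ + 1 + 1) * r ≤ 8 ^ D := by
    have h1 : r ≤ 2 ^ (Nat.log 2 r + 1) := (Nat.lt_pow_succ_log_self (by norm_num) r).le
    have h2 : 288 * (Δ + 2) ≤ 2 ^ (288 * (Δ + 2)) := Nat.lt_two_pow_self.le
    calc 288 * (Δ + 1 + 1) * r ≤ 2 ^ (288 * (Δ + 2)) * 2 ^ (Nat.log 2 r + 1) := Nat.mul_le_mul h2 h1
      _ = 2 ^ D := by rw [← pow_add, hD]; congr 1; ring
      _ ≤ 8 ^ D := Nat.pow_le_pow_left (by norm_num) _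
  obtain ⟨N, G, hG, hcard⟩ := SizeRamsey.exists_arrows (L := Δ + 1) (Nat.succ_pos _)
    (by omega : 0 < r) hn hq hT rfl fun v => by have := (T.degree_le_maxDegree v).trans hdeg; omega
  have hle : SizeRamsey.sizeRamsey r T ≤ G.edgeSet.encard := sInf_le ⟨N, G, hG, rfl⟩
  replace hle := hle.trans hcard
  obtain ⟨m, hm⟩ := ENat.ne_top_iff_exists.1 (ne_top_of_le_ne_top (ENat.natCast_ne_top _) hle)
  refine ⟨m, hm.symm, ?_⟩
  rw [← hm, Nat.cast_le] at hle
  have hr' : (2 : ℝ) ≤ r := by exact_mod_cast hr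
  have hlog : Real.log 2 ≤ Real.log r := Real.log_le_log (by norm_num) hr'
  have hNlog : (Nat.log 2 r : ℝ) * Real.log 2 ≤ Real.log r := by
    rw [← Real.log_pow]
    exact Real.log_le_log (by positivity) (by exact_mod_cast Nat.pow_log_le_self 2 (by omega))
  -- Since `r ≥ 2`, the constant part of `D` is absorbed into a multiple of `log r`.
  have hDlog : (D : ℝ) ≤ (2 + 288 * (Δ + 2)) * Real.log r / Real.log 2 := by
    rw [le_div_iff₀ hlog2, hD]
    push_cast
    have := mul_le_mul_of_nonneg_left hlog (by positivity : (0 : ℝ) ≤ 288 * (Δ + 2))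
    linarith
  calc (m : ℝ) ≤ _ := Nat.cast_le.2 hle
    _ = 48 * (Δ + 2) ^ 3 * D * r ^ 2 * Fintype.card V := by push_cast; ring
    _ ≤ 48 * (Δ + 2) ^ 3 * ((2 + 288 * (Δ + 2)) * Real.log r / Real.log 2) * r ^ 2 *
          Fintype.card V := by gcongr
    _ = _ := by ring
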